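/- Let $\mathcal C\subset\mathbb C^3$ be an irreducible algebraic curve, let $\mathcal C^p\subset\mathbb C^2$ be the (Zariski closure of the) projection of $\mathcal C$ along the $x_3$-axis, and assume that the $x_3$-axis is a valid projection direction, i.e. that the projection $\mathcal C\to\mathcal C^p$ is birational. A lift function is a rational function $h=h_1/h_2$, with $h_1,h_2\in\mathbb C[x_1,x_2]$ and $h_2$ not identically zero on $\mathcal C^p$, such that, wherever $h_2(x_1,x_2)\neq0$, one has $(x_1,x_2,x_3)\in\mathcal C$ iff $(x_1,x_2)\in\mathcal C^p$ and $x_3=h(x_1,x_2)$. Let $\mathbb C\ll t\gg=\bigcup_{n\ge1}\mathbb C((t^{1/n}))$ be the field of Puiseux series. For $\varphi_2,\dots,\varphi_n\in\mathbb C\ll t\gg$ put $r_k(z)=z\varphi_k(1/z)$. One says that $\{(z,r_2(z),\dots,r_n(z)):z\in\mathbb C,\ |z|>M\}$, $M>0$, is an infinity branch of an algebraic set $V\subset\mathbb C^n$ if $(z,r_2(z),\dots,r_n(z))$ formally satisfies all the polynomial equations of $V$, the series $r_k(z)$ converge for $|z|>M$, and the union of all the leaves $\{(z,r_{j,2}(z),\dots,r_{j,n}(z)):|z|>M\}$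 obtained from the simultaneous conjugates of $(r_2,\dots,r_n)$ is contained in $V$. It is associated to the infinity point $(1:m_2:\dots:m_n:0)$ if this is a point of the projective closure of $V$ and each $\varphi_k$ has the form $\varphi_k(t)=m_k+(\text{terms with positive exponents})$. Then: 1. For every series $r_2(z)=z\varphi_2(1/z)$, the set $B^p=\{(z,r_2(z)):|z|>M^p\}$ is an infinity branch of $\mathcal C^p$ for some $M^p>0$ if and only if there is a series $r_3(z)=z\varphi_3(1/z)$, $\varphi_3\in\mathbb C\ll z\gg$, such that $B=\{(z,r_2(z),r_3(z)):|z|>M\}$ is an infinity branch of $\mathcal C$ for some $M>0$. 2. If moreover all the infinity points of $\mathcal C$ (points of its projective closure at infinity) have nonzero first coordinate, then for every $m_2\in\mathbb C$ and every $r_2$, $B^p$ is, for some $M^p>0$, an infinity branch of $\mathcal C^p$ associated to $(1:m_2:0)$ if and only if there are $m_3\in\mathbb C$ and $r_3$ such that $B$ is, for some $M>0$, an infinity branch of $\mathcal C$ associated to $(1:m_2:m_3:0)$. 3. A lift function exists, and for every lift function $h=h_1/h_2$ and every infinity branch $B=\{(z,r_2(z),r_3(z)):|z|>M\}$ of $\mathcal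 C$ one has $h_2(z,r_2(z))\neq0$ and $r_3(z)=h(z,r_2(z))$ as formal series. -/

import Mathlib

noncomputable section

namespace SpaceCurve

open MvPolynomial

/-! ### Puiseux series -/

/-- A Hahn series with rational exponents is a *(formal) Puiseux series* if its exponents have a
common denominator, i.e. if it lies in `⋃ₙ ℂ((t^(1/n)))`. -/
def IsPuiseux (φ : HahnSeries ℚ ℂ) : Prop :=
  ∃ N : ℕ, 0 < N ∧ ∀ q : ℚ, φ.coeff q ≠ 0 → ∃ j : ℤ, q * N = j

/-- The ramification index of a tuple of Puiseux series: the least common denominator of all the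
exponents that occur in it (the lcm of the ramification indices of its components). -/
def ramificationIndex {n : ℕ} (φ : Fin n → HahnSeries ℚ ℂ) : ℕ :=
  sInf {N : ℕ | 0 < N ∧ ∀ k, ∀ q : ℚ, (φ k).coeff q ≠ 0 → ∃ j : ℤ, q * N = j}

/-! ### Affine algebraic curves, infinity points, projection -/

/-- An irreducible affine algebraic curve in `ℂⁿ`: an irreducible Zariski closed set of
dimension one. -/
structure IsIrreducibleCurve {n : ℕ} (V : Set (Fin n → ℂ)) : Prop where
  closed : zeroLocus ℂ (vanishingIdeal ℂ V) = V
  prime : (vanishingIdeal ℂ V).IsPrime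
  dim : ringKrullDim (MvPolynomial (Fin n) ℂ ⧸ vanishingIdeal ℂ V) = 1

/-- `(m₁ : … : mₙ : 0)` is an *infinity point* of `V`, i.e. a point of the projective closure of
`V` on the hyperplane at infinity: the homogenizations of all the polynomials that vanish on `V`
vanish at it, and at a point with last coordinate `0` the homogenization of `f` takes the value
of the top degree form of `f`. -/
def IsInfinityPoint {n : ℕ} (V : Set (Fin n → ℂ)) (m : Fin n → ℂ) : Prop :=
  m ≠ 0 ∧ ∀ f ∈ vanishingIdeal ℂ V, eval m (homogeneousComponent f.totalDegree f) = 0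

/-- The projection of `ℂ³` along the `x₃`-axis. -/
def proj (x : Fin 3 → ℂ) : Fin 2 → ℂ := ![x 0, x 1]

/-- The projection `C^p` of a space curve along the `x₃`-axis, as an algebraic set: the Zariski
closure of the image. -/
def projectedCurve (C : Set (Fin 3 → ℂ)) : Set (Fin 2 → ℂ) :=
  zeroLocus ℂ (vanishingIdeal ℂ (proj '' C))

/-- The `x₃`-axis is a *valid projection direction* for `C`: the projection `C → C^p` is
birational, that is, it has a rational inverse `(p₀/q, p₁/q, p₂/q)` with `q` not identically
zero on `C^p`. -/
def IsValidProjection (C : Set (Fin 3 → ℂ)) : Prop :=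
  ∃ (p : Fin 3 → MvPolynomial (Fin 2) ℂ) (q : MvPolynomial (Fin 2) ℂ),
    (∃ y ∈ projectedCurve C, eval y q ≠ 0) ∧
    (∀ y ∈ projectedCurve C, eval y q ≠ 0 →
      (fun i => eval y (p i) / eval y q) ∈ C ∧
      proj (fun i => eval y (p i) / eval y q) = y) ∧
    (∀ x ∈ C, eval (proj x) q ≠ 0 →
      (fun i => eval (proj x) (p i) / eval (proj x) q) = x)

/-- `h = h₁ / h₂` is a *lift function* for `C`: `h₂` is not identically zero on `C^p` and, wherever
`h₂ ≠ 0`, `(x₁, x₂, x₃) ∈ C` iff `(x₁, x₂) ∈ C^p` and `x₃ = h (x₁, x₂)`. -/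
def IsLiftFunction (C : Set (Fin 3 → ℂ)) (h₁ h₂ : MvPolynomial (Fin 2) ℂ) : Prop :=
  (∃ y ∈ projectedCurve C, eval y h₂ ≠ 0) ∧
  ∀ x : Fin 3 → ℂ, eval (proj x) h₂ ≠ 0 →
    (x ∈ C ↔ proj x ∈ projectedCurve C ∧ x 2 = eval (proj x) h₁ / eval (proj x) h₂)

/-! ### Infinity branches -/

/-- The formal series `z = 1/t`. -/
def zSeries : HahnSeries ℚ ℂ := HahnSeries.single (-1) 1

/-- The formal series `r(z) = z φ(1/z)` attached to `φ`, written in the variable `t = 1/z`. -/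
def rSeries (φ : HahnSeries ℚ ℂ) : HahnSeries ℚ ℂ := zSeries * φ

/-- The formal point `(z, r₂(z), r₃(z), …)`. -/
def formalPoint {n : ℕ} (φ : Fin n → HahnSeries ℚ ℂ) : Fin (n + 1) → HahnSeries ℚ ℂ :=
  Fin.cons zSeries fun k => rSeries (φ k)

/-- The value at `z ∈ ℂ` of the conjugate of `r(z) = z φ(1/z)` given by an `N`-th root of unity
`c`: the term `a z^(1 - q)` of `r` is replaced by `a c^(q N) z^(1 - q)`. The powers of `z` are
principal ones; `q N` is an integer whenever `N` is a common denominator of the exponents. -/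
def leafValue (N : ℕ) (c : ℂ) (φ : HahnSeries ℚ ℂ) (z : ℂ) : ℂ :=
  ∑' q : ℚ, φ.coeff q * c ^ (q * N).num * z ^ (1 - (q : ℂ))

/-- The leaf `L = {(z, r₂(z), r₃(z), …) : |z| > M}` belonging to the root of unity `c`. -/
def leaf {n : ℕ} (φ : Fin n → HahnSeries ℚ ℂ) (M : ℝ) (c : ℂ) : Set (Fin (n + 1) → ℂ) :=
  {x | ∃ z : ℂ, M < ‖z‖ ∧
    x = Fin.cons z fun k => leafValue (ramificationIndex φ) c (φ k) z}

/-- The set `B = ⋃ⱼ Lⱼ`, the union of all the conjugate leaves. -/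
def branchSet {n : ℕ} (φ : Fin n → HahnSeries ℚ ℂ) (M : ℝ) : Set (Fin (n + 1) → ℂ) :=
  ⋃ c ∈ {c : ℂ | c ^ ramificationIndex φ = 1}, leaf φ M c

/-- `B = {(z, r₂(z), r₃(z), …) : |z| > M}` with `rₖ(z) = z φₖ(1/z)` is an *infinity branch* of `V`:
the `φₖ` are Puiseux series, `(z, r₂(z), r₃(z), …)` formally satisfies the equations of `V`, the
series converge for `|z| > M`, and the union of the conjugate leaves they define lies on `V`. -/
structure IsInfinityBranch {n : ℕ} (V : Set (Fin (n + 1) → ℂ)) (φ : Fin n → HahnSeries ℚ ℂ)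
    (M : ℝ) : Prop where
  pos : 0 < M
  puiseux : ∀ k, IsPuiseux (φ k)
  formal : ∀ f ∈ vanishingIdeal ℂ V, aeval (formalPoint φ) f = 0
  summable : ∀ k, ∀ z : ℂ, M < ‖z‖ → Summable fun q : ℚ => (φ k).coeff q * z ^ (1 - (q : ℂ))
  subset : branchSet φ M ⊆ V

/-- An infinity branch *associated to the infinity point* `(1 : m₂ : m₃ : … : 0)`: moreover
`φₖ(t) = mₖ + (terms with positive exponents)`, and that point is an infinity point of `V`. -/
structure IsInfinityBranchAt {n : ℕ} (V : Set (Fin (n + 1) → ℂ)) (m : Fin n → ℂ)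
    (φ : Fin n → HahnSeries ℚ ℂ) (M : ℝ) : Prop extends IsInfinityBranch V φ M where
  point : IsInfinityPoint V (Fin.cons 1 m)
  order : ∀ k, ∀ q : ℚ, q < 0 → (φ k).coeff q = 0
  constantTerm : ∀ k, (φ k).coeff 0 = m k

end SpaceCurve

end

noncomputable section

namespace SpaceCurve

open MvPolynomial

/-! The third coordinate of a branch is forced: it must be h(z, r₂(z)) for a lift function h, and
conversely this formula defines the lifted branch. Formally, `z` is transcendental over ℂ, and a
point of an irreducible variety of dimension at most one with a transcendental coordinate is generic
(`mem_of_aeval_eq_zero_of_transcendental`). Hence h₂ cannot vanish at the formal point of C^p, the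
quotient makes sense, and clearing denominators carries the equations of C^p to those of C
(`IsLiftFunction.aeval_eq_zero`) and back (`IsLiftFunction.rSeries_eq`). Analytically, convergent
Puiseux series are closed under sums, products and inverses (`IsConvergent.inv`), so the lifted
series converges. Formal equations and convergence already give the inclusion of all conjugate
leaves (`isInfinityBranch_of_formal`), since evaluation at any N-th root of 1/z respects
polynomials. For infinity points, a pole of φ₃ would make the branch tend to (0:0:1:0), which the
assumption on C excludes (`coeff_eq_zero_of_neg`). -/

/-! ### The projected curve: elimination ideal, lift functions, dimension -/

lemma proj_eq_comp_castSucc (x : Fin 3 → ℂ) : proj x = x ∘ Fin.castSucc := by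
  ext i
  fin_cases i <;> rfl

lemma vanishingIdeal_projectedCurve (C : Set (Fin 3 → ℂ)) :
    vanishingIdeal ℂ (projectedCurve C) = vanishingIdeal ℂ (proj '' C) :=
  le_antisymm (vanishingIdeal_anti_mono (zeroLocus_vanishingIdeal_le _))
    (le_vanishingIdeal_zeroLocus _)

lemma zeroLocus_vanishingIdeal_projectedCurve (C : Set (Fin 3 → ℂ)) :
    zeroLocus ℂ (vanishingIdeal ℂ (projectedCurve C)) = projectedCurve C := by
  rw [vanishingIdeal_projectedCurve]
  rfl

lemma proj_mem_projectedCurve {C : Set (Fin 3 → ℂ)} {x : Fin 3 → ℂ} (hx : x ∈ C) :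
    proj x ∈ projectedCurve C :=
  zeroLocus_vanishingIdeal_le _ ⟨x, hx, rfl⟩

/-- The ideal of C^p is the elimination ideal of C; as a contraction it inherits primality. -/
lemma mem_vanishingIdeal_projectedCurve_iff {C : Set (Fin 3 → ℂ)} {f : MvPolynomial (Fin 2) ℂ} :
    f ∈ vanishingIdeal ℂ (projectedCurve C) ↔
      rename Fin.castSucc f ∈ vanishingIdeal ℂ C := by
  rw [vanishingIdeal_projectedCurve, mem_vanishingIdeal_iff, mem_vanishingIdeal_iff]
  simp only [Set.forall_mem_image, aeval_rename, proj_eq_comp_castSucc]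

lemma isPrime_vanishingIdeal_projectedCurve {C : Set (Fin 3 → ℂ)}
    (hC : (vanishingIdeal ℂ C).IsPrime) :
    (vanishingIdeal ℂ (projectedCurve C)).IsPrime := by
  have : vanishingIdeal ℂ (projectedCurve C) =
      (vanishingIdeal ℂ C).comap (rename (R := ℂ) (Fin.castSucc : Fin 2 → Fin 3)) := by
    ext f
    rw [mem_vanishingIdeal_projectedCurve_iff, Ideal.mem_comap]
  rw [this]
  exact Ideal.comap_isPrime _ _

/-- A point of a one-dimensional irreducible variety with a transcendental coordinate is generic. -/
lemma mem_of_aeval_eq_zero_of_transcendental {n : ℕ} {I : Ideal (MvPolynomial (Fin n) ℂ)}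
    (hI : I.IsPrime) (hdim : ringKrullDim (MvPolynomial (Fin n) ℂ ⧸ I) ≤ 1)
    {K : Type*} [Field K] [Algebra ℂ K] {x : Fin n → K} (hx : ∀ f ∈ I, aeval x f = 0)
    {i : Fin n} (hi : Transcendental ℂ (x i)) {f : MvPolynomial (Fin n) ℂ}
    (hf : aeval x f = 0) : f ∈ I := by
  by_contra hfI
  have hle : Ring.KrullDimLE 1 (MvPolynomial (Fin n) ℂ ⧸ I) := Ring.krullDimLE_iff.2 hdim
  -- The kernel P of evaluation at x strictly contains I, so in dimension at most one it is maximal.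
  -- By the Nullstellensatz it is the ideal of a complex point a, which makes x i the constant a i.
  let P : Ideal (MvPolynomial (Fin n) ℂ) := RingHom.ker (aeval (R := ℂ) x)
  have hP : P.IsPrime := RingHom.ker_isPrime _
  have hIP : I ≤ P := fun g hg => hx g hg
  have hPmap : (P.map (Ideal.Quotient.mk I)).IsPrime :=
    Ideal.map_isPrime_of_surjective Ideal.Quotient.mk_surjective (by simpa using hIP)
  have hne : P.map (Ideal.Quotient.mk I) ≠ ⊥ := by
    intro h
    rw [Ideal.map_eq_bot_iff_le_ker, Ideal.mk_ker] at h
    exact hfI (h hf)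
  have hmax := hPmap.isMaximal_of_ne_bot hne
  have hPmax : P.IsMaximal := by
    have := Ideal.comap_isMaximal_of_surjective (Ideal.Quotient.mk I)
      Ideal.Quotient.mk_surjective (K := P.map (Ideal.Quotient.mk I))
    rwa [Ideal.comap_map_of_surjective _ Ideal.Quotient.mk_surjective, ← RingHom.ker_eq_comap_bot,
      Ideal.mk_ker, sup_eq_left.2 hIP] at this
  obtain ⟨a, ha⟩ := isMaximal_iff_eq_vanishingIdeal_singleton.1 hPmax
  have hmem : X i - C (a i) ∈ P := by
    rw [ha, mem_vanishingIdeal_singleton_iff]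
    simp
  have hxi : x i = algebraMap ℂ K (a i) := by
    have : aeval x (X i - C (a i)) = 0 := hmem
    simpa [sub_eq_zero] using this
  exact hi (hxi ▸ isAlgebraic_algebraMap _)

/-- Substituting `h₁ / h₂` for the last variable and clearing denominators. -/
lemma exists_aeval_eq_pow_mul_aeval (h₁ h₂ : MvPolynomial (Fin 2) ℂ)
    (f : MvPolynomial (Fin 3) ℂ) :
    ∃ (D : ℕ) (F : MvPolynomial (Fin 2) ℂ), ∀ (K : Type) [Field K] [Algebra ℂ K] (y : Fin 2 → K),
      aeval y h₂ ≠ 0 →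
        aeval y F = aeval y h₂ ^ D * aeval ![y 0, y 1, aeval y h₁ / aeval y h₂] f := by
  induction f using MvPolynomial.induction_on with
  | C a => exact ⟨0, C a, fun K _ _ y _ => by simp⟩
  | add f g hf hg =>
    obtain ⟨D, F, hF⟩ := hf
    obtain ⟨E, G, hG⟩ := hg
    refine ⟨D + E, F * h₂ ^ E + G * h₂ ^ D, fun K _ _ y hy => ?_⟩
    simp only [map_add, map_mul, map_pow, hF K y hy, hG K y hy]
    ring
  | mul_X f i hf =>
    obtain ⟨D, F, hF⟩ := hf
    fin_cases i
    · refine ⟨D, F * X 0, fun K _ _ y hy => ?_⟩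
      simp [hF K y hy, mul_assoc]
    · refine ⟨D, F * X 1, fun K _ _ y hy => ?_⟩
      simp [hF K y hy, mul_assoc]
    · refine ⟨D + 1, F * h₁, fun K _ _ y hy => ?_⟩
      simp only [map_mul, hF K y hy, aeval_X, Fin.reduceFinMk, Matrix.cons_val]
      field_simp
      ring

/-- A lift function lifts the zeros of `I(C^p)` in any field extension to zeros of `I(C)`. -/
lemma IsLiftFunction.aeval_eq_zero {C : Set (Fin 3 → ℂ)} {h₁ h₂ : MvPolynomial (Fin 2) ℂ}
    (h : IsLiftFunction C h₁ h₂) {K : Type} [Field K] [Algebra ℂ K] {y : Fin 2 → K}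
    (hy : ∀ f ∈ vanishingIdeal ℂ (projectedCurve C), aeval y f = 0) (hy₂ : aeval y h₂ ≠ 0)
    {f : MvPolynomial (Fin 3) ℂ} (hf : f ∈ vanishingIdeal ℂ C) :
    aeval ![y 0, y 1, aeval y h₁ / aeval y h₂] f = 0 := by
  obtain ⟨D, F, hF⟩ := exists_aeval_eq_pow_mul_aeval h₁ h₂ f
  -- The extra factor h₂ takes care of the points of C^p where h₂ vanishes and nothing is known
  -- about F. The same F serves over ℂ here and over K below.
  have hmem : h₂ * F ∈ vanishingIdeal ℂ (projectedCurve C) := by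
    intro w hw
    by_cases hw₂ : aeval w h₂ = 0
    · rw [map_mul, hw₂, zero_mul]
    · have hwC : ![w 0, w 1, aeval w h₁ / aeval w h₂] ∈ C := by
        have hp : proj ![w 0, w 1, aeval w h₁ / aeval w h₂] = w := by
          ext i
          fin_cases i <;> rfl
        rw [h.2 _ (by rw [hp]; exact hw₂), hp]
        exact ⟨hw, rfl⟩
      rw [map_mul, hF ℂ w hw₂, hf _ hwC, mul_zero, mul_zero]
  have := hy _ hmem
  rw [map_mul, hF K y hy₂] at this
  simpa [hy₂] using this

/-- The third component of the rational inverse is a lift function. -/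
lemma IsValidProjection.exists_isLiftFunction {C : Set (Fin 3 → ℂ)} (h : IsValidProjection C) :
    ∃ h₁ h₂ : MvPolynomial (Fin 2) ℂ, IsLiftFunction C h₁ h₂ := by
  obtain ⟨p, q, hq, hpC, hp⟩ := h
  refine ⟨p 2, q, hq, fun x hx => ⟨fun hxC => ⟨proj_mem_projectedCurve hxC, ?_⟩, ?_⟩⟩
  · exact (congrFun (hp x hxC hx) 2).symm
  · rintro ⟨hxp, hx2⟩
    obtain ⟨hmem, hpr⟩ := hpC _ hxp hx
    convert hmem using 1
    ext i
    fin_cases i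
    · exact (congrFun hpr 0).symm
    · exact (congrFun hpr 1).symm
    · exact hx2

/-- If C^p were the whole plane, the generic point of a line x₁ = y₀ would lift to C. Having a
transcendental coordinate it is generic on C, so x₁ would be constant on C and on C^p. -/
lemma vanishingIdeal_projectedCurve_ne_bot {C : Set (Fin 3 → ℂ)} (hC : IsIrreducibleCurve C)
    {h₁ h₂ : MvPolynomial (Fin 2) ℂ} (h : IsLiftFunction C h₁ h₂) :
    vanishingIdeal ℂ (projectedCurve C) ≠ ⊥ := by
  intro hbot
  obtain ⟨y, -, hy⟩ := h.1
  let w : Fin 2 → RatFunc ℂ := ![algebraMap ℂ _ (y 0), RatFunc.X]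
  -- Specializing the variable to y 1 turns w into y, where h₂ is nonzero.
  have hw₂ : aeval w h₂ ≠ 0 := by
    let w' : Fin 2 → Polynomial ℂ := ![Polynomial.C (y 0), Polynomial.X]
    have hww' : w = fun i => algebraMap (Polynomial ℂ) (RatFunc ℂ) (w' i) := by
      ext i
      fin_cases i
      · exact (RatFunc.algebraMap_C (y 0)).symm
      · exact RatFunc.algebraMap_X.symm
    have hw' : aeval w h₂ = algebraMap (Polynomial ℂ) (RatFunc ℂ) (aeval w' h₂) := by
      rw [hww', ← aeval_algebraMap_apply]
      rfl
    rw [hw']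
    intro h0
    have h0' : aeval w' h₂ = 0 :=
      (map_eq_zero_iff _ (RatFunc.algebraMap_injective ℂ)).1 h0
    apply hy
    have := congrArg (Polynomial.aeval (y 1)) h0'
    rw [map_zero, ← AlgHom.comp_apply, comp_aeval] at this
    have hyw : (fun i => Polynomial.aeval (y 1) (w' i)) = y := by
      ext i
      fin_cases i <;> simp [w']
    rwa [hyw] at this
  have hI : ∀ f ∈ vanishingIdeal ℂ C, aeval ![w 0, w 1, aeval w h₁ / aeval w h₂] f = 0 :=
    fun f hf => h.aeval_eq_zero (by simp [hbot]) hw₂ hf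
  have hmem : X (Fin.castSucc 0) - MvPolynomial.C (y 0) ∈ vanishingIdeal ℂ C :=
    mem_of_aeval_eq_zero_of_transcendental (i := 1) hC.prime hC.dim.le hI
      (by simpa [w] using RatFunc.transcendental_X) (by simp [w])
  have hmem' : X 0 - MvPolynomial.C (y 0) ∈ vanishingIdeal ℂ (projectedCurve C) := by
    rw [mem_vanishingIdeal_projectedCurve_iff]
    simpa using hmem
  rw [hbot, Ideal.mem_bot] at hmem'
  have := congrArg (eval ![y 0 + 1, 0]) hmem'
  simp at this

/-- A nonzero equation lowers the dimension 2 of the plane. -/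
lemma ringKrullDim_projectedCurve_le {C : Set (Fin 3 → ℂ)} (hC : IsIrreducibleCurve C)
    {h₁ h₂ : MvPolynomial (Fin 2) ℂ} (h : IsLiftFunction C h₁ h₂) :
    ringKrullDim (MvPolynomial (Fin 2) ℂ ⧸ vanishingIdeal ℂ (projectedCurve C)) ≤ 1 := by
  obtain ⟨f, hf, hf0⟩ := Submodule.exists_mem_ne_zero_of_ne_bot
    (vanishingIdeal_projectedCurve_ne_bot hC h)
  have h1 := ringKrullDim_quotient_succ_le_of_nonZeroDivisor (mem_nonZeroDivisors_of_ne_zero hf0)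
  have h2 : ringKrullDim (MvPolynomial (Fin 2) ℂ ⧸ vanishingIdeal ℂ (projectedCurve C)) ≤
      ringKrullDim (MvPolynomial (Fin 2) ℂ ⧸ Ideal.span {f}) :=
    ringKrullDim_le_of_surjective _
      (Ideal.Quotient.factor_surjective ((Ideal.span_singleton_le_iff_mem _).2 hf))
  rw [MvPolynomial.ringKrullDim_of_isNoetherianRing, ringKrullDim_eq_zero_of_field, Nat.card_fin,
    zero_add] at h1
  refine h2.trans ?_
  have h3 : ringKrullDim (MvPolynomial (Fin 2) ℂ ⧸ Ideal.span {f}) + 1 ≤ 1 + 1 := by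
    rw [one_add_one_eq_two]
    exact_mod_cast h1
  exact ENat.WithBot.add_le_add_one_right_iff.1 h3

/-! ### Absolutely convergent power series -/

/-- The power series `P` converges absolutely at `u`. -/
def AbsConvergesAt (P : PowerSeries ℂ) (u : ℂ) : Prop :=
  Summable fun n : ℕ => ‖PowerSeries.coeff n P * u ^ n‖

/-- The sum of the power series `P` at `u`. -/
def evalSum (P : PowerSeries ℂ) (u : ℂ) : ℂ :=
  ∑' n : ℕ, PowerSeries.coeff n P * u ^ n

lemma AbsConvergesAt.mono {P : PowerSeries ℂ} {u v : ℂ} (h : AbsConvergesAt P u)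
    (hv : ‖v‖ ≤ ‖u‖) : AbsConvergesAt P v :=
  h.of_nonneg_of_le (fun _ => norm_nonneg _) fun n => by
    simp only [norm_mul, norm_pow]
    gcongr

lemma AbsConvergesAt.add {P Q : PowerSeries ℂ} {u : ℂ} (hP : AbsConvergesAt P u)
    (hQ : AbsConvergesAt Q u) : AbsConvergesAt (P + Q) u :=
  (Summable.add hP hQ).of_nonneg_of_le (fun _ => norm_nonneg _) fun n => by
    rw [map_add, add_mul]
    exact norm_add_le _ _

lemma evalSum_add {P Q : PowerSeries ℂ} {u : ℂ} (hP : AbsConvergesAt P u)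
    (hQ : AbsConvergesAt Q u) : evalSum (P + Q) u = evalSum P u + evalSum Q u := by
  rw [evalSum, evalSum, evalSum, ← hP.of_norm.tsum_add hQ.of_norm]
  simp only [map_add, add_mul]

lemma coeff_mul_mul_pow (P Q : PowerSeries ℂ) (u : ℂ) (n : ℕ) :
    PowerSeries.coeff n (P * Q) * u ^ n = ∑ kl ∈ Finset.HasAntidiagonal.antidiagonal n,
      (PowerSeries.coeff kl.1 P * u ^ kl.1) * (PowerSeries.coeff kl.2 Q * u ^ kl.2) := by
  rw [PowerSeries.coeff_mul, Finset.sum_mul]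
  refine Finset.sum_congr rfl fun kl hkl => ?_
  rw [← Finset.HasAntidiagonal.mem_antidiagonal.1 hkl, pow_add]
  ring

lemma AbsConvergesAt.mul {P Q : PowerSeries ℂ} {u : ℂ} (hP : AbsConvergesAt P u)
    (hQ : AbsConvergesAt Q u) : AbsConvergesAt (P * Q) u := by
  simpa only [AbsConvergesAt, coeff_mul_mul_pow] using
    summable_norm_sum_mul_antidiagonal_of_summable_norm hP hQ

lemma evalSum_mul {P Q : PowerSeries ℂ} {u : ℂ} (hP : AbsConvergesAt P u)
    (hQ : AbsConvergesAt Q u) : evalSum (P * Q) u = evalSum P u * evalSum Q u := by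
  simp only [evalSum, coeff_mul_mul_pow]
  exact (tsum_mul_tsum_eq_tsum_sum_antidiagonal_of_summable_norm hP hQ).symm

lemma absConvergesAt_of_finite {P : PowerSeries ℂ} {m : ℕ}
    (h : ∀ n, n ≠ m → PowerSeries.coeff n P = 0) (u : ℂ) : AbsConvergesAt P u :=
  summable_of_ne_finset_zero (s := {m}) fun n hn => by
    rw [h n (by simpa using hn), zero_mul, norm_zero]

lemma absConvergesAt_C (a u : ℂ) : AbsConvergesAt (PowerSeries.C a) u :=
  absConvergesAt_of_finite (m := 0) (fun n hn => by simp [PowerSeries.coeff_C, hn]) u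

lemma evalSum_C (a u : ℂ) : evalSum (PowerSeries.C a) u = a := by
  rw [evalSum, tsum_eq_single 0 fun n hn => by simp [PowerSeries.coeff_C, hn]]
  simp

lemma absConvergesAt_X_pow (m : ℕ) (u : ℂ) : AbsConvergesAt (PowerSeries.X ^ m) u :=
  absConvergesAt_of_finite (m := m) (fun n hn => by simp [PowerSeries.coeff_X_pow, hn]) u

lemma evalSum_X_pow (m : ℕ) (u : ℂ) : evalSum (PowerSeries.X ^ m) u = u ^ m := by
  rw [evalSum, tsum_eq_single m fun n hn => by simp [PowerSeries.coeff_X_pow, hn]]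
  simp [PowerSeries.coeff_X_pow]

/-- A power series inverse to a convergent one has a positive radius of convergence. -/
lemma exists_absConvergesAt_of_mul_eq_one {P Q : PowerSeries ℂ} (hPQ : P * Q = 1) {r : ℝ}
    (hr : 0 < r) (hP : AbsConvergesAt P r) : ∃ s : ℝ, 0 < s ∧ AbsConvergesAt Q s := by
  have h0 : PowerSeries.coeff 0 P * PowerSeries.coeff 0 Q = 1 := by
    simpa using congrArg (PowerSeries.coeff 0) hPQ
  have hP0 : PowerSeries.coeff 0 P ≠ 0 := left_ne_zero_of_mul_eq_one h0
  have hP0' : 0 < ‖PowerSeries.coeff 0 P‖ := norm_pos_iff.2 hP0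
  set a : ℕ → ℝ := fun n => ‖PowerSeries.coeff (n + 1) P‖ with ha
  set b : ℕ → ℝ := fun n => ‖PowerSeries.coeff n Q‖ with hb
  have hsum : Summable fun n => a n * r ^ (n + 1) := by
    have := (summable_nat_add_iff 1).2 hP
    simpa [ha, abs_of_pos hr] using this
  set A := ∑' n, a n * r ^ (n + 1) with hA
  have hA0 : 0 ≤ A := tsum_nonneg fun n => by positivity
  -- a radius at which the non-constant part of `P` is at most half of the constant term
  obtain ⟨θ, hθ0, hθ1, hθ⟩ : ∃ θ : ℝ, 0 < θ ∧ θ ≤ 1 ∧ θ * A ≤ ‖PowerSeries.coeff 0 P‖ / 2 := by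
    -- The denominator is A + 1 because A may be 0.
    refine ⟨min 1 (‖PowerSeries.coeff 0 P‖ / 2 / (A + 1)), by positivity, min_le_left _ _, ?_⟩
    calc _ ≤ ‖PowerSeries.coeff 0 P‖ / 2 / (A + 1) * A := by gcongr; exact min_le_right _ _
      _ ≤ ‖PowerSeries.coeff 0 P‖ / 2 / (A + 1) * (A + 1) := by gcongr; linarith
      _ = _ := by field_simp
  set s := θ * r with hs
  have hs0 : 0 < s := by positivity
  have hpart : ∀ n, ∑ k ∈ Finset.range n, a k * s ^ (k + 1) ≤ ‖PowerSeries.coeff 0 P‖ / 2 := by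
    intro n
    refine le_trans ?_ hθ
    rw [hA, ← tsum_mul_left]
    refine le_trans (Finset.sum_le_sum fun k _ => ?_)
      ((hsum.mul_left θ).sum_le_tsum (Finset.range n) fun k _ => by positivity)
    rw [hs, mul_pow, mul_left_comm]
    gcongr
    exact pow_le_of_le_one hθ0.le hθ1 (Nat.succ_ne_zero k)
  -- Vanishing of the coefficient of degree n + 1 in PQ = 1, solved for that of Q.
  have hrec : ∀ n, ‖PowerSeries.coeff 0 P‖ * (b (n + 1) * s ^ (n + 1)) ≤
      ∑ k ∈ Finset.range (n + 1), (a k * s ^ (k + 1)) * (b (n - k) * s ^ (n - k)) := by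
    intro n
    have h1 : PowerSeries.coeff (n + 1) (P * Q) = 0 := by
      rw [hPQ, PowerSeries.coeff_one, if_neg (Nat.succ_ne_zero n)]
    rw [PowerSeries.coeff_mul, Finset.Nat.sum_antidiagonal_eq_sum_range_succ_mk,
      Finset.sum_range_succ'] at h1
    have h2 : PowerSeries.coeff 0 P * PowerSeries.coeff (n + 1) Q =
        -∑ k ∈ Finset.range (n + 1), PowerSeries.coeff (k + 1) P *
          PowerSeries.coeff (n - k) Q := by
      rw [eq_neg_iff_add_eq_zero, add_comm]
      simpa using h1
    have h3 : ‖PowerSeries.coeff 0 P‖ * b (n + 1) ≤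
        ∑ k ∈ Finset.range (n + 1), a k * b (n - k) := by
      rw [hb, ← norm_mul, h2, norm_neg]
      refine (norm_sum_le _ _).trans_eq (Finset.sum_congr rfl fun k _ => norm_mul _ _)
    rw [← mul_assoc]
    refine (mul_le_mul_of_nonneg_right h3 (by positivity)).trans_eq ?_
    rw [Finset.sum_mul]
    refine Finset.sum_congr rfl fun k hk => ?_
    have hkn : n + 1 = (k + 1) + (n - k) := by have := Finset.mem_range.1 hk; omega
    rw [hkn, pow_add]
    ring
  -- Summing the recursion bounds the tail of each partial sum by half of the preceding partial sum,
  -- so the bound 2 b₀ reproduces itself. The triangular double sum is enlarged to a square to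
  -- factor it.
  have hbound : ∀ n, ∑ k ∈ Finset.range n, b k * s ^ k ≤ 2 * b 0 := by
    intro n
    induction n with
    | zero => simp [hb]
    | succ n ih =>
      have h4 : ‖PowerSeries.coeff 0 P‖ * ∑ k ∈ Finset.range n, b (k + 1) * s ^ (k + 1) ≤
          ‖PowerSeries.coeff 0 P‖ / 2 * (2 * b 0) := by
        rw [Finset.mul_sum]
        calc _ ≤ ∑ m ∈ Finset.range n, ∑ k ∈ Finset.range (m + 1),
                (a k * s ^ (k + 1)) * (b (m - k) * s ^ (m - k)) :=
              Finset.sum_le_sum fun m _ => hrec m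
          _ = ∑ k ∈ Finset.range n, ∑ j ∈ Finset.range (n - k),
                (a k * s ^ (k + 1)) * (b j * s ^ j) :=
              Finset.sum_range_diag_flip n fun k j => (a k * s ^ (k + 1)) * (b j * s ^ j)
          _ ≤ ∑ k ∈ Finset.range n, ∑ j ∈ Finset.range n,
                (a k * s ^ (k + 1)) * (b j * s ^ j) := by
              refine Finset.sum_le_sum fun k _ => Finset.sum_le_sum_of_subset_of_nonneg
                (Finset.range_mono (Nat.sub_le n k)) fun _ _ _ => by positivity
          _ = (∑ k ∈ Finset.range n, a k * s ^ (k + 1)) * ∑ j ∈ Finset.range n, b j * s ^ j :=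
              Finset.sum_mul_sum _ _ _ _ |>.symm
          _ ≤ _ := mul_le_mul (hpart n) ih (Finset.sum_nonneg fun _ _ => by positivity)
              (by positivity)
      have h5 : ∑ k ∈ Finset.range n, b (k + 1) * s ^ (k + 1) ≤ b 0 := by
        refine le_of_mul_le_mul_left (h4.trans_eq ?_) hP0'
        ring
      rw [Finset.sum_range_succ']
      simp only [pow_zero, mul_one]
      linarith
  refine ⟨s, hs0, summable_of_sum_range_le (c := 2 * b 0) (fun _ => norm_nonneg _) fun n => ?_⟩
  refine le_trans (le_of_eq (Finset.sum_congr rfl fun k _ => ?_)) (hbound n)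
  simp [hb, abs_of_pos hs0]

/-! ### Puiseux series as power series in a root of the variable -/

/-- Substitution of `t ^ (1 / N)` for the variable of a power series. -/
def puiseuxHom (N : ℕ) [NeZero N] : PowerSeries ℂ →+* HahnSeries ℚ ℂ :=
  (HahnSeries.embDomainRingHom
    (AddMonoidHom.mk' (fun n : ℕ => (n : ℚ) / N) fun a b => by push_cast; ring)
    (fun a b h => by simpa [div_left_inj' (NeZero.ne (N : ℚ))] using h)
    (fun a b => by
      have : (0 : ℚ) < N := by exact_mod_cast NeZero.pos N
      simp [div_le_div_iff_of_pos_right this])).comp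
  (RingEquiv.toRingHom HahnSeries.toPowerSeries.symm)

lemma coeff_puiseuxHom (N : ℕ) [NeZero N] (P : PowerSeries ℂ) (n : ℕ) :
    (puiseuxHom N P).coeff ((n : ℚ) / N) = PowerSeries.coeff n P :=
  HahnSeries.embDomain_coeff (x := HahnSeries.toPowerSeries.symm P) (a := n)

lemma coeff_puiseuxHom_of_ne (N : ℕ) [NeZero N] (P : PowerSeries ℂ) {q : ℚ}
    (hq : ∀ n : ℕ, q ≠ (n : ℚ) / N) : (puiseuxHom N P).coeff q = 0 :=
  HahnSeries.embDomain_of_notMem_range fun ⟨n, hn⟩ => hq n hn.symm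

lemma puiseuxHom_injective (N : ℕ) [NeZero N] : Function.Injective (puiseuxHom N) := by
  intro P Q h
  ext n
  rw [← coeff_puiseuxHom N, h, coeff_puiseuxHom]

lemma puiseuxHom_C (N : ℕ) [NeZero N] (a : ℂ) :
    puiseuxHom N (PowerSeries.C a) = HahnSeries.C a := by
  ext q
  by_cases hq : ∃ n : ℕ, q = (n : ℚ) / N
  · obtain ⟨n, rfl⟩ := hq
    rw [coeff_puiseuxHom]
    simp [PowerSeries.coeff_C, HahnSeries.coeff_single, NeZero.ne]
  · push Not at hq
    rw [coeff_puiseuxHom_of_ne N _ hq, HahnSeries.C_apply, HahnSeries.coeff_single_of_ne]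
    simpa using hq 0

lemma puiseuxHom_X_pow (N : ℕ) [NeZero N] (m : ℕ) :
    puiseuxHom N (PowerSeries.X ^ m) = HahnSeries.single ((m : ℚ) / N) 1 := by
  ext q
  by_cases hq : ∃ n : ℕ, q = (n : ℚ) / N
  · obtain ⟨n, rfl⟩ := hq
    rw [coeff_puiseuxHom]
    simp [PowerSeries.coeff_X_pow, HahnSeries.coeff_single,
      div_left_inj' (NeZero.ne (N : ℚ))]
  · push Not at hq
    rw [coeff_puiseuxHom_of_ne N _ hq, HahnSeries.coeff_single_of_ne (hq m)]

/-- `φ = t ^ (-m / N) P(t ^ (1 / N))`. -/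
def IsExpansion (N : ℕ) [NeZero N] (φ : HahnSeries ℚ ℂ) (m : ℕ) (P : PowerSeries ℂ) : Prop :=
  φ * HahnSeries.single ((m : ℚ) / N) 1 = puiseuxHom N P

section Expansion

variable {N : ℕ} [NeZero N] {φ ψ : HahnSeries ℚ ℂ} {m k : ℕ} {P Q : PowerSeries ℂ}

lemma single_div_add (N : ℕ) [NeZero N] (m k : ℕ) :
    (HahnSeries.single (((m + k : ℕ) : ℚ) / N) 1 : HahnSeries ℚ ℂ) =
      HahnSeries.single ((m : ℚ) / N) 1 * HahnSeries.single ((k : ℚ) / N) 1 := by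
  rw [HahnSeries.single_mul_single, one_mul, Nat.cast_add, add_div]

/-- Expansions need not be reduced: m only bounds the pole order, so cross-multiplication is enough.
-/
lemma IsExpansion.add (h : IsExpansion N φ m P) (h' : IsExpansion N ψ k Q) :
    IsExpansion N (φ + ψ) (m + k) (P * PowerSeries.X ^ k + Q * PowerSeries.X ^ m) := by
  unfold IsExpansion at *
  rw [map_add, map_mul, map_mul, ← h, ← h', puiseuxHom_X_pow, puiseuxHom_X_pow, single_div_add]
  ring

lemma IsExpansion.mul (h : IsExpansion N φ m P) (h' : IsExpansion N ψ k Q) :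
    IsExpansion N (φ * ψ) (m + k) (P * Q) := by
  unfold IsExpansion at *
  rw [map_mul, ← h, ← h', single_div_add]
  ring

lemma isExpansion_C (N : ℕ) [NeZero N] (a : ℂ) :
    IsExpansion N (HahnSeries.C a) 0 (PowerSeries.C a) := by
  simp [IsExpansion, puiseuxHom_C]

lemma isExpansion_zSeries (N : ℕ) [NeZero N] : IsExpansion N zSeries N 1 := by
  simp [IsExpansion, zSeries, NeZero.ne]

lemma IsExpansion.coeff (h : IsExpansion N φ m P) (n : ℕ) :
    φ.coeff (((n : ℚ) - m) / N) = PowerSeries.coeff n P := by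
  rw [← coeff_puiseuxHom N, ← h, HahnSeries.coeff_mul_single, mul_one, sub_div]

lemma IsExpansion.coeff_of_ne (h : IsExpansion N φ m P) {q : ℚ}
    (hq : ∀ n : ℕ, q ≠ ((n : ℚ) - m) / N) : φ.coeff q = 0 := by
  have := coeff_puiseuxHom_of_ne N P (q := q + m / N) fun n hn => hq n (by
    rw [sub_div, ← hn, add_sub_cancel_right])
  rwa [← h, HahnSeries.coeff_mul_single, mul_one, add_sub_cancel_right] at this

lemma sub_div_injective (N : ℕ) [NeZero N] (m : ℕ) :
    Function.Injective fun n : ℕ => ((n : ℚ) - m) / N := fun a b h => by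
  simpa [div_left_inj' (NeZero.ne (N : ℚ))] using h

lemma IsExpansion.support_subset (h : IsExpansion N φ m P) (w : ℚ → ℂ) {q : ℚ}
    (hq : q ∉ Set.range fun n : ℕ => ((n : ℚ) - m) / N) : φ.coeff q * w q = 0 := by
  rw [h.coeff_of_ne fun n hn => hq ⟨n, hn.symm⟩, zero_mul]

/-- Sums over rational exponents become sums over ℕ; the weight w will be a power of z, possibly
twisted by a root of unity. -/
lemma IsExpansion.summable_iff (h : IsExpansion N φ m P) (w : ℚ → ℂ) :
    (Summable fun q => φ.coeff q * w q) ↔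
      Summable fun n : ℕ => PowerSeries.coeff n P * w (((n : ℚ) - m) / N) := by
  rw [← (sub_div_injective N m).summable_iff fun q hq => h.support_subset w hq]
  simp only [Function.comp_def, h.coeff]

lemma IsExpansion.tsum_eq (h : IsExpansion N φ m P) (w : ℚ → ℂ) :
    ∑' q, φ.coeff q * w q =
      ∑' n : ℕ, PowerSeries.coeff n P * w (((n : ℚ) - m) / N) := by
  rw [← (sub_div_injective N m).tsum_eq (f := fun q => φ.coeff q * w q)]
  · simp only [h.coeff]
  · intro q hq
    by_contra hq'
    exact hq (h.support_subset w hq')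

lemma IsExpansion.isPuiseux (h : IsExpansion N φ m P) : IsPuiseux φ := by
  refine ⟨N, NeZero.pos N, fun q hq => ?_⟩
  by_contra! hj
  refine hq (h.coeff_of_ne fun n hn => hj (n - m) ?_)
  rw [hn, div_mul_cancel₀ _ (NeZero.ne (N : ℚ))]
  push_cast
  rfl

lemma exists_isExpansion (N : ℕ) [NeZero N]
    (h : ∀ q : ℚ, φ.coeff q ≠ 0 → ∃ j : ℤ, q * N = j) : ∃ m P, IsExpansion N φ m P := by
  have hN : (0 : ℚ) < N := by exact_mod_cast NeZero.pos N
  -- Any such m clears the negative exponents, including for φ = 0, whose `order` is 0 by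
  -- convention.
  obtain ⟨m, hm⟩ := exists_nat_ge (-φ.order * N)
  refine ⟨m, PowerSeries.mk fun n => φ.coeff (((n : ℚ) - m) / N), ?_⟩
  ext q
  rw [HahnSeries.coeff_mul_single, mul_one]
  by_cases hq : ∃ n : ℕ, q = (n : ℚ) / N
  · obtain ⟨n, rfl⟩ := hq
    rw [coeff_puiseuxHom, PowerSeries.coeff_mk, sub_div]
  · push Not at hq
    rw [coeff_puiseuxHom_of_ne N _ hq]
    by_contra hne
    obtain ⟨j, hj⟩ := h _ hne
    have hord : φ.order ≤ q - m / N := HahnSeries.order_le_of_coeff_ne_zero hne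
    have hqN : q * N = j + m := by
      rw [← hj, sub_mul, div_mul_cancel₀ _ hN.ne']
      ring
    have h0 : (0 : ℚ) ≤ j + m := by
      have := mul_le_mul_of_nonneg_right hord hN.le
      rw [hj] at this
      linarith
    obtain ⟨n, hn⟩ := Int.eq_ofNat_of_zero_le (a := j + m) (by exact_mod_cast h0)
    refine hq n ?_
    rw [eq_div_iff hN.ne', hqN]
    exact_mod_cast hn

end Expansion

/-- The value of `φ` at the point where `t ^ (1 / N)` takes the value `u` is `v`. -/
def HasValueAt (N : ℕ) [NeZero N] (u : ℂ) (φ : HahnSeries ℚ ℂ) (v : ℂ) : Prop :=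
  ∃ m P, IsExpansion N φ m P ∧ AbsConvergesAt P u ∧ v * u ^ m = evalSum P u

section HasValueAt

variable {N : ℕ} [NeZero N] {u : ℂ} {φ ψ : HahnSeries ℚ ℂ} {v w : ℂ}

lemma hasValueAt_C (N : ℕ) [NeZero N] (u a : ℂ) : HasValueAt N u (HahnSeries.C a) a :=
  ⟨0, _, isExpansion_C N a, absConvergesAt_C a u, by rw [evalSum_C, pow_zero, mul_one]⟩

lemma HasValueAt.add (h : HasValueAt N u φ v) (h' : HasValueAt N u ψ w) :
    HasValueAt N u (φ + ψ) (v + w) := by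
  obtain ⟨m, P, hP, hPu, hv⟩ := h
  obtain ⟨k, Q, hQ, hQu, hw⟩ := h'
  have h1 := hPu.mul (absConvergesAt_X_pow k u)
  have h2 := hQu.mul (absConvergesAt_X_pow m u)
  refine ⟨_, _, hP.add hQ, h1.add h2, ?_⟩
  rw [evalSum_add h1 h2, evalSum_mul hPu (absConvergesAt_X_pow k u),
    evalSum_mul hQu (absConvergesAt_X_pow m u), evalSum_X_pow, evalSum_X_pow, ← hv, ← hw]
  ring

lemma HasValueAt.mul (h : HasValueAt N u φ v) (h' : HasValueAt N u ψ w) :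
    HasValueAt N u (φ * ψ) (v * w) := by
  obtain ⟨m, P, hP, hPu, hv⟩ := h
  obtain ⟨k, Q, hQ, hQu, hw⟩ := h'
  refine ⟨_, _, hP.mul hQ, hPu.mul hQu, ?_⟩
  rw [evalSum_mul hPu hQu, ← hv, ← hw]
  ring

/-- Together with `HasValueAt.aeval`, this turns formal polynomial relations into numerical ones. -/
lemma HasValueAt.eq_zero (h : HasValueAt N u 0 v) (hu : u ≠ 0) : v = 0 := by
  obtain ⟨m, P, hP, -, hv⟩ := h
  have hP0 : P = 0 := by
    apply puiseuxHom_injective N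
    rw [← hP, zero_mul, map_zero]
  rw [hP0] at hv
  simpa [evalSum, hu] using hv

lemma algebraMap_hahnSeries (a : ℂ) :
    algebraMap ℂ (HahnSeries ℚ ℂ) a = HahnSeries.C a :=
  HahnSeries.ofPowerSeries_C a

lemma HasValueAt.aeval {n : ℕ} {x : Fin n → HahnSeries ℚ ℂ} {y : Fin n → ℂ}
    (h : ∀ i, HasValueAt N u (x i) (y i)) (f : MvPolynomial (Fin n) ℂ) :
    HasValueAt N u (aeval x f) (aeval y f) := by
  induction f using MvPolynomial.induction_on with
  | C a =>
    rw [aeval_C, aeval_C, algebraMap_hahnSeries]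
    exact hasValueAt_C N u a
  | add f g hf hg => simpa only [map_add] using hf.add hg
  | mul_X f i hf => simpa only [map_mul, aeval_X] using hf.mul (h i)

end HasValueAt

/-! ### Convergence of Puiseux series and the leaves of a branch -/

lemma cpow_neg_inv_pow (N : ℕ) [NeZero N] (z : ℂ) : (z ^ (-(N : ℂ)⁻¹)) ^ N = z⁻¹ := by
  rw [← Complex.cpow_nat_mul, mul_neg, mul_inv_cancel₀ (NeZero.ne (N : ℂ)), Complex.cpow_neg_one]

/-- With u = z^(-1/N) and q = (n - m)/N this is z^(1-q) = z u^(n-m); all powers are principal powers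
of one z, so there is no branch ambiguity. -/
lemma cpow_one_sub_div (N : ℕ) [NeZero N] {z : ℂ} (hz : z ≠ 0) (n m : ℕ) :
    z ^ (1 - (((n - m) / N : ℚ) : ℂ)) =
      z * (z ^ (-(N : ℂ)⁻¹)) ^ n * ((z ^ (-(N : ℂ)⁻¹)) ^ m)⁻¹ := by
  rw [← Complex.cpow_nat_mul, ← Complex.cpow_nat_mul, ← Complex.cpow_neg]
  nth_rewrite 2 [← Complex.cpow_one z]
  rw [← Complex.cpow_add _ _ hz, ← Complex.cpow_add _ _ hz]
  congr 1
  push_cast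
  ring

lemma cpow_neg_inv_ne_zero (N : ℕ) {z : ℂ} (hz : z ≠ 0) : z ^ (-(N : ℂ)⁻¹) ≠ 0 := by
  simp [Complex.cpow_eq_zero_iff, hz]

lemma IsExpansion.summable_cpow_iff {N : ℕ} [NeZero N] {φ : HahnSeries ℚ ℂ} {m : ℕ}
    {P : PowerSeries ℂ} (h : IsExpansion N φ m P) {z : ℂ} (hz : z ≠ 0) :
    (Summable fun q : ℚ => φ.coeff q * z ^ (1 - (q : ℂ))) ↔
      AbsConvergesAt P (z ^ (-(N : ℂ)⁻¹)) := by
  rw [h.summable_iff fun q => z ^ (1 - (q : ℂ)), AbsConvergesAt, summable_norm_iff]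
  simp only [cpow_one_sub_div N hz]
  rw [← summable_mul_left_iff (a := z * ((z ^ (-(N : ℂ)⁻¹)) ^ m)⁻¹)
    (mul_ne_zero hz (inv_ne_zero (pow_ne_zero _ (cpow_neg_inv_ne_zero N hz))))
    (f := fun n => PowerSeries.coeff n P * (z ^ (-(N : ℂ)⁻¹)) ^ n)]
  refine summable_congr fun n => ?_
  ring

lemma hasValueAt_zSeries (N : ℕ) [NeZero N] {u z : ℂ} (hz : z ≠ 0) (hu : u ^ N = z⁻¹) :
    HasValueAt N u zSeries z := by
  refine ⟨N, 1, isExpansion_zSeries N, ?_, ?_⟩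
  · simpa using absConvergesAt_C 1 u
  · rw [hu, mul_inv_cancel₀ hz]
    simpa using (evalSum_C 1 u).symm

/-- Conjugating by c amounts to replacing the root u of 1/z by cu. Absolute convergence is
unaffected because |c| = 1. -/
lemma hasValueAt_leafValue {N : ℕ} [NeZero N] {φ : HahnSeries ℚ ℂ}
    (hφ : ∀ q : ℚ, φ.coeff q ≠ 0 → ∃ j : ℤ, q * N = j) {z c : ℂ} (hz : z ≠ 0) (hc : c ^ N = 1)
    (hs : Summable fun q : ℚ => φ.coeff q * z ^ (1 - (q : ℂ))) :
    HasValueAt N (c * z ^ (-(N : ℂ)⁻¹)) (rSeries φ) (leafValue N c φ z) := by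
  obtain ⟨m, P, hP⟩ := exists_isExpansion N hφ
  have hc1 : ‖c‖ = 1 := Complex.norm_eq_one_of_pow_eq_one hc (NeZero.ne N)
  have hc0 : c ≠ 0 := norm_ne_zero_iff.1 (by rw [hc1]; exact one_ne_zero)
  set ζ := z ^ (-(N : ℂ)⁻¹) with hζ
  have hζ0 : ζ ≠ 0 := cpow_neg_inv_ne_zero N hz
  have hζN : ζ ^ N = z⁻¹ := cpow_neg_inv_pow N z
  have hPu : AbsConvergesAt P (c * ζ) :=
    ((hP.summable_cpow_iff hz).1 hs).mono (by rw [norm_mul, hc1, one_mul])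
  refine ⟨N + m, 1 * P, (isExpansion_zSeries N).mul hP, by rwa [one_mul], ?_⟩
  have hval : leafValue N c φ z = evalSum P (c * ζ) * (z * ((c * ζ) ^ m)⁻¹) := by
    unfold leafValue
    simp only [mul_assoc]
    rw [hP.tsum_eq fun q : ℚ => c ^ (q * N).num * z ^ (1 - (q : ℂ)), evalSum, ← tsum_mul_right]
    refine tsum_congr fun n => ?_
    have hnum : (((n : ℚ) - m) / N * N).num = (n : ℤ) - m := by
      rw [div_mul_cancel₀ _ (NeZero.ne (N : ℚ))]
      exact_mod_cast Rat.num_intCast ((n : ℤ) - m)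
    rw [hnum, cpow_one_sub_div N hz, zpow_sub₀ hc0, zpow_natCast, zpow_natCast, ← hζ, mul_pow,
      mul_pow, mul_inv]
    ring
  have hcζ : (c * ζ) ^ m ≠ 0 := pow_ne_zero _ (mul_ne_zero hc0 hζ0)
  rw [hval, one_mul, pow_add, mul_pow c ζ N, hc, hζN]
  field_simp

lemma ramificationIndex_spec {n : ℕ} {φ : Fin n → HahnSeries ℚ ℂ} (h : ∀ k, IsPuiseux (φ k)) :
    0 < ramificationIndex φ ∧ ∀ k, ∀ q : ℚ, (φ k).coeff q ≠ 0 →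
      ∃ j : ℤ, q * ramificationIndex φ = j := by
  choose N hN hj using h
  -- The infimum is attained once some common denominator exists; the product of the individual ones
  -- is one.
  refine Nat.sInf_mem (s := {N : ℕ | 0 < N ∧ ∀ k, ∀ q : ℚ, (φ k).coeff q ≠ 0 →
    ∃ j : ℤ, q * N = j}) ⟨∏ k, N k, Finset.prod_pos fun k _ => hN k, fun k q hq => ?_⟩
  obtain ⟨j, hj⟩ := hj k q hq
  refine ⟨j * ∏ i ∈ Finset.univ.erase k, N i, ?_⟩
  rw [← Finset.mul_prod_erase _ _ (Finset.mem_univ k)]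
  push_cast
  rw [← hj, mul_assoc]

/-- Convergent Puiseux series that formally satisfy the equations of `V` form an infinity
branch. -/
lemma isInfinityBranch_of_formal {n : ℕ} {V : Set (Fin (n + 1) → ℂ)}
    (hV : zeroLocus ℂ (vanishingIdeal ℂ V) = V) {φ : Fin n → HahnSeries ℚ ℂ} {M : ℝ} (hM : 0 < M)
    (hφ : ∀ k, IsPuiseux (φ k)) (hf : ∀ f ∈ vanishingIdeal ℂ V, aeval (formalPoint φ) f = 0)
    (hs : ∀ k, ∀ z : ℂ, M < ‖z‖ → Summable fun q : ℚ => (φ k).coeff q * z ^ (1 - (q : ℂ))) :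
    IsInfinityBranch V φ M := by
  refine ⟨hM, hφ, hf, hs, ?_⟩
  obtain ⟨hN, hj⟩ := ramificationIndex_spec hφ
  have : NeZero (ramificationIndex φ) := ⟨hN.ne'⟩
  intro x hx
  simp only [branchSet, Set.mem_iUnion, leaf, Set.mem_ofPred_eq, exists_prop] at hx
  obtain ⟨c, hc, z, hz, rfl⟩ := hx
  have hz0 : z ≠ 0 := norm_pos_iff.1 (hM.trans hz)
  have hc0 : c ≠ 0 := by
    rintro rfl
    rw [zero_pow hN.ne'] at hc
    exact zero_ne_one hc
  rw [← hV]
  intro f hfV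
  -- The point of the leaf is the value of the formal point at the root c z^(-1/N) of 1/z.
  have hval := HasValueAt.aeval (N := ramificationIndex φ)
    (u := c * z ^ (-(ramificationIndex φ : ℂ)⁻¹)) (x := formalPoint φ)
    (y := Fin.cons z fun k => leafValue (ramificationIndex φ) c (φ k) z) (fun i => by
      refine Fin.cases ?_ (fun k => ?_) i
      · exact hasValueAt_zSeries (z := z) _ hz0 (by rw [mul_pow, hc, cpow_neg_inv_pow, one_mul])
      · exact hasValueAt_leafValue (hj k) hz0 hc (hs k z hz)) f
  rw [hf f hfV] at hval
  exact hval.eq_zero (mul_ne_zero hc0 (cpow_neg_inv_ne_zero _ hz0))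

/-- Puiseux series in `t ^ (1 / N)` with a positive radius of convergence. -/
def IsConvergent (N : ℕ) [NeZero N] (φ : HahnSeries ℚ ℂ) : Prop :=
  ∃ r : ℝ, 0 < r ∧ ∃ m P, IsExpansion N φ m P ∧ AbsConvergesAt P r

section IsConvergent

variable {N : ℕ} [NeZero N] {φ ψ : HahnSeries ℚ ℂ}

lemma AbsConvergesAt.of_le {P : PowerSeries ℂ} {r s : ℝ} (h : AbsConvergesAt P r) (hs : 0 ≤ s)
    (hsr : s ≤ r) : AbsConvergesAt P s :=
  h.mono (by simpa [abs_of_nonneg hs, abs_of_nonneg (hs.trans hsr)] using hsr)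

lemma IsConvergent.add (h : IsConvergent N φ) (h' : IsConvergent N ψ) :
    IsConvergent N (φ + ψ) := by
  obtain ⟨r, hr, m, P, hP, hPr⟩ := h
  obtain ⟨s, hs, k, Q, hQ, hQs⟩ := h'
  have h0 : 0 < min r s := lt_min hr hs
  exact ⟨min r s, h0, _, _, hP.add hQ,
    ((hPr.of_le h0.le (min_le_left _ _)).mul (absConvergesAt_X_pow _ _)).add
      ((hQs.of_le h0.le (min_le_right _ _)).mul (absConvergesAt_X_pow _ _))⟩

lemma IsConvergent.mul (h : IsConvergent N φ) (h' : IsConvergent N ψ) :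
    IsConvergent N (φ * ψ) := by
  obtain ⟨r, hr, m, P, hP, hPr⟩ := h
  obtain ⟨s, hs, k, Q, hQ, hQs⟩ := h'
  have h0 : 0 < min r s := lt_min hr hs
  exact ⟨min r s, h0, _, _, hP.mul hQ,
    (hPr.of_le h0.le (min_le_left _ _)).mul (hQs.of_le h0.le (min_le_right _ _))⟩

lemma isConvergent_C (N : ℕ) [NeZero N] (a : ℂ) : IsConvergent N (HahnSeries.C a) :=
  ⟨1, one_pos, _, _, isExpansion_C N a, absConvergesAt_C a _⟩

lemma isConvergent_zSeries (N : ℕ) [NeZero N] : IsConvergent N zSeries :=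
  ⟨1, one_pos, _, _, isExpansion_zSeries N, by simpa using absConvergesAt_C 1 ((1 : ℝ) : ℂ)⟩

lemma IsConvergent.aeval {n : ℕ} {x : Fin n → HahnSeries ℚ ℂ} (h : ∀ i, IsConvergent N (x i))
    (f : MvPolynomial (Fin n) ℂ) : IsConvergent N (aeval x f) := by
  induction f using MvPolynomial.induction_on with
  | C a =>
    rw [aeval_C, algebraMap_hahnSeries]
    exact isConvergent_C N a
  | add f g hf hg => simpa only [map_add] using hf.add hg
  | mul_X f i hf => simpa only [map_mul, aeval_X] using hf.mul (h i)

lemma AbsConvergesAt.divXPowOrder {P : PowerSeries ℂ} {r : ℝ} (hr : 0 < r)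
    (h : AbsConvergesAt P r) : AbsConvergesAt P.divXPowOrder r := by
  have h1 := ((summable_nat_add_iff P.order.toNat).2 h).mul_right (r ^ P.order.toNat)⁻¹
  refine h1.congr fun n => ?_
  rw [PowerSeries.coeff_divXPowOrder, norm_mul, norm_mul, norm_pow, norm_pow, Complex.norm_real,
    Real.norm_of_nonneg hr.le, pow_add]
  field_simp

/-- Factor P as a power of X times a series with nonzero constant term: the power becomes the new
pole bound, and the second factor has a convergent inverse. -/
lemma IsConvergent.inv (h : IsConvergent N φ) : IsConvergent N φ⁻¹ := by
  rcases eq_or_ne φ 0 with rfl | hφ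
  · simpa using isConvergent_C N 0
  obtain ⟨r, hr, m, P, hP, hPr⟩ := h
  have hP0 : P ≠ 0 := by
    rintro rfl
    rw [IsExpansion, map_zero] at hP
    exact (mul_ne_zero hφ (HahnSeries.single_ne_zero one_ne_zero)) hP
  have hinv : P.divXPowOrder * P.divXPowOrder⁻¹ = 1 :=
    PowerSeries.mul_inv_cancel _ (by simpa [PowerSeries.constantCoeff_divXPowOrder_eq_zero_iff])
  obtain ⟨s, hs, hQs⟩ := exists_absConvergesAt_of_mul_eq_one hinv hr (hPr.divXPowOrder hr)
  refine ⟨s, hs, P.order.toNat, PowerSeries.X ^ m * P.divXPowOrder⁻¹, ?_,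
    (absConvergesAt_X_pow m _).mul hQs⟩
  have h1 : φ * puiseuxHom N (PowerSeries.X ^ m) =
      puiseuxHom N (PowerSeries.X ^ P.order.toNat) * puiseuxHom N P.divXPowOrder := by
    rw [← map_mul, PowerSeries.X_pow_order_mul_divXPowOrder, puiseuxHom_X_pow]
    exact hP
  have h2 : puiseuxHom N P.divXPowOrder * puiseuxHom N P.divXPowOrder⁻¹ = 1 := by
    rw [← map_mul, hinv, map_one]
  rw [IsExpansion, map_mul, ← puiseuxHom_X_pow]
  apply mul_left_cancel₀ hφ
  rw [mul_inv_cancel_left₀ hφ, ← mul_assoc, h1, mul_assoc, h2, mul_one]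

lemma IsConvergent.exists_summable (h : IsConvergent N φ) :
    ∃ M : ℝ, 0 < M ∧ ∀ z : ℂ, M < ‖z‖ → Summable fun q : ℚ => φ.coeff q * z ^ (1 - (q : ℂ)) := by
  obtain ⟨r, hr, m, P, hP, hPr⟩ := h
  have hM : 0 < (r ^ N)⁻¹ := by positivity
  -- The root u of 1/z satisfies |u| ≤ r exactly when |z| ≥ r^(-N).
  refine ⟨(r ^ N)⁻¹, hM, fun z hz => ?_⟩
  rw [hP.summable_cpow_iff (norm_pos_iff.1 (hM.trans hz))]
  refine hPr.mono ?_
  rw [Complex.norm_real, Real.norm_of_nonneg hr.le]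
  refine le_of_pow_le_pow_left₀ (NeZero.ne N) hr.le ?_
  rw [← norm_pow, cpow_neg_inv_pow, norm_inv]
  exact inv_le_of_inv_le₀ (by positivity) hz.le

/-- Summability in ℂ is absolute, so a single nonzero z gives a positive radius. -/
lemma isConvergent_of_summable (hφ : ∀ q : ℚ, φ.coeff q ≠ 0 → ∃ j : ℤ, q * N = j) {z : ℂ}
    (hz : z ≠ 0) (hs : Summable fun q : ℚ => φ.coeff q * z ^ (1 - (q : ℂ))) :
    IsConvergent N φ := by
  obtain ⟨m, P, hP⟩ := exists_isExpansion N hφ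
  refine ⟨‖z ^ (-(N : ℂ)⁻¹)‖, norm_pos_iff.2 (cpow_neg_inv_ne_zero N hz), m, P, hP,
    ((hP.summable_cpow_iff hz).1 hs).mono ?_⟩
  simp

lemma IsConvergent.isPuiseux (h : IsConvergent N φ) : IsPuiseux φ := by
  obtain ⟨r, hr, m, P, hP, -⟩ := h
  exact hP.isPuiseux

end IsConvergent

/-! ### Residues and infinity points -/

/-- `φ = a + (terms with positive exponents)`. -/
def HasResidue (φ : HahnSeries ℚ ℂ) (a : ℂ) : Prop :=
  0 < (φ - HahnSeries.C a).orderTop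

section HasResidue

variable {φ ψ : HahnSeries ℚ ℂ} {a b : ℂ}

lemma hasResidue_C (a : ℂ) : HasResidue (HahnSeries.C a) a := by
  simp [HasResidue]

lemma hasResidue_zero_iff : HasResidue φ 0 ↔ 0 < φ.orderTop := by
  simp [HasResidue]

lemma HasResidue.add (h : HasResidue φ a) (h' : HasResidue ψ b) : HasResidue (φ + ψ) (a + b) := by
  have : φ + ψ - HahnSeries.C (a + b) = (φ - HahnSeries.C a) + (ψ - HahnSeries.C b) := by
    rw [map_add]
    ring
  rw [HasResidue, this]
  exact (lt_min h h').trans_le HahnSeries.min_orderTop_le_orderTop_add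

lemma HasResidue.mul (h : HasResidue φ a) (h' : HasResidue ψ b) : HasResidue (φ * ψ) (a * b) := by
  have h1 : φ * ψ - HahnSeries.C (a * b) = (φ - HahnSeries.C a) * (ψ - HahnSeries.C b) +
      ((φ - HahnSeries.C a) * HahnSeries.C b + HahnSeries.C a * (ψ - HahnSeries.C b)) := by
    rw [map_mul]
    ring
  have hC : ∀ c : ℂ, 0 ≤ (HahnSeries.C c : HahnSeries ℚ ℂ).orderTop := fun c =>
    HahnSeries.orderTop_single_le
  rw [HasResidue, h1]
  refine (lt_min ?_ ((lt_min ?_ ?_).trans_le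
    HahnSeries.min_orderTop_le_orderTop_add)).trans_le HahnSeries.min_orderTop_le_orderTop_add
  · rw [HahnSeries.orderTop_mul]
    exact h.trans_le (le_add_of_nonneg_right (le_of_lt h'))
  · rw [HahnSeries.orderTop_mul]
    exact h.trans_le (le_add_of_nonneg_right (hC b))
  · rw [HahnSeries.orderTop_mul]
    exact h'.trans_le (le_add_of_nonneg_left (hC a))

lemma HasResidue.aeval {n : ℕ} {x : Fin n → HahnSeries ℚ ℂ} {m : Fin n → ℂ}
    (h : ∀ i, HasResidue (x i) (m i)) (f : MvPolynomial (Fin n) ℂ) :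
    HasResidue (aeval x f) (eval m f) := by
  induction f using MvPolynomial.induction_on with
  | C a =>
    rw [aeval_C, eval_C, algebraMap_hahnSeries]
    exact hasResidue_C a
  | add f g hf hg => simpa only [map_add] using hf.add hg
  | mul_X f i hf => simpa only [map_mul, aeval_X, eval_X] using hf.mul (h i)

lemma HasResidue.pow (h : HasResidue φ a) (k : ℕ) : HasResidue (φ ^ k) (a ^ k) := by
  induction k with
  | zero => simpa using hasResidue_C 1
  | succ k ih => simpa only [pow_succ] using ih.mul h

lemma HasResidue.sum {ι : Type*} (s : Finset ι) {φ : ι → HahnSeries ℚ ℂ} {a : ι → ℂ}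
    (h : ∀ i ∈ s, HasResidue (φ i) (a i)) : HasResidue (∑ i ∈ s, φ i) (∑ i ∈ s, a i) := by
  classical
  induction s using Finset.induction_on with
  | empty => simpa using hasResidue_C 0
  | insert i s hi ih =>
    rw [Finset.sum_insert hi, Finset.sum_insert hi]
    exact (h i (Finset.mem_insert_self i s)).add
      (ih fun j hj => h j (Finset.mem_insert_of_mem hj))

lemma HasResidue.eq_zero (h : HasResidue 0 a) : a = 0 := by
  by_contra ha
  rw [HasResidue, zero_sub, HahnSeries.orderTop_neg, HahnSeries.C_apply,
    HahnSeries.orderTop_single ha] at h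
  exact lt_irrefl _ h

lemma zero_lt_orderTop_of_coeff (h : ∀ q : ℚ, q ≤ 0 → φ.coeff q = 0) : 0 < φ.orderTop := by
  by_contra! hle
  have hne : φ ≠ 0 := by
    rintro rfl
    simp at hle
  rw [← HahnSeries.order_eq_orderTop_of_ne_zero hne] at hle
  exact HahnSeries.coeff_order_eq_zero.not.2 hne (h _ (by exact_mod_cast hle))

lemma hasResidue_of_coeff (h : ∀ q : ℚ, q < 0 → φ.coeff q = 0) : HasResidue φ (φ.coeff 0) := by
  refine zero_lt_orderTop_of_coeff fun q hq => ?_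
  rw [HahnSeries.coeff_sub, HahnSeries.C_apply]
  rcases hq.lt_or_eq with hq | rfl
  · rw [h q hq, HahnSeries.coeff_single_of_ne hq.ne, sub_zero]
  · rw [HahnSeries.coeff_single_same, sub_self]

end HasResidue

lemma aeval_mul_of_isHomogeneous {n d : ℕ} {K : Type*} [Field K] [Algebra ℂ K]
    {f : MvPolynomial (Fin n) ℂ} (hf : f.IsHomogeneous d) (l : K) (x : Fin n → K) :
    aeval (fun i => l * x i) f = l ^ d * aeval x f := by
  rw [aeval_def, aeval_def, eval₂_eq', eval₂_eq', Finset.mul_sum]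
  refine Finset.sum_congr rfl fun e he => ?_
  have hd : ∑ i, e i = d := by
    rw [← hf (mem_support_iff.1 he), Finsupp.weight_apply, Finsupp.sum_fintype _ _ (by simp)]
    simp
  simp only [mul_pow, Finset.prod_mul_distrib, Finset.prod_pow_eq_pow_sum, hd]
  ring

/-- The limit at infinity of a formal point of `V` is an infinity point of `V`. -/
lemma isInfinityPoint_of_hasResidue {n : ℕ} {V : Set (Fin n → ℂ)} {x : Fin n → HahnSeries ℚ ℂ}
    (hx : ∀ f ∈ vanishingIdeal ℂ V, aeval x f = 0) {l : HahnSeries ℚ ℂ} (hl : HasResidue l 0)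
    {m : Fin n → ℂ} (hm : ∀ i, HasResidue (l * x i) (m i)) (hm0 : m ≠ 0) :
    IsInfinityPoint V m := by
  refine ⟨hm0, fun f hf => ?_⟩
  -- Multiply f(x) = 0 by l^d with d the total degree: the part of degree k becomes l^(d-k) f_k(lx),
  -- whose residue is 0 for k < d. Only the top form survives, as 0^0 = 1.
  have hterm : ∀ k ∈ Finset.range (f.totalDegree + 1),
      HasResidue (l ^ f.totalDegree * aeval x (homogeneousComponent k f))
        (0 ^ (f.totalDegree - k) * eval m (homogeneousComponent k f)) := by
    intro k hk
    have hk' : f.totalDegree = f.totalDegree - k + k := by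
      have := Finset.mem_range.1 hk
      omega
    have : l ^ f.totalDegree * aeval x (homogeneousComponent k f) =
        l ^ (f.totalDegree - k) * aeval (fun i => l * x i) (homogeneousComponent k f) := by
      rw [aeval_mul_of_isHomogeneous (homogeneousComponent_isHomogeneous k f), ← mul_assoc,
        ← pow_add, ← hk']
    rw [this]
    exact (hl.pow _).mul (HasResidue.aeval hm _)
  have hsum := HasResidue.sum _ hterm
  rw [← Finset.mul_sum, ← map_sum, sum_homogeneousComponent, hx f hf, mul_zero] at hsum
  have h0 := hsum.eq_zero
  rw [Finset.sum_range_succ, Nat.sub_self, pow_zero, one_mul, Finset.sum_eq_zero, zero_add] at h0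
  · exact h0
  · intro k hk
    rw [zero_pow (Nat.sub_ne_zero_of_lt (Finset.mem_range.1 hk)), zero_mul]

/-! ### Lifting infinity branches -/

lemma zSeries_ne_zero : zSeries ≠ 0 :=
  HahnSeries.single_ne_zero one_ne_zero

/-- An element algebraic over the algebraically closed field ℂ is a constant, and constants have no
coefficient at exponent -1. -/
lemma transcendental_zSeries : Transcendental ℂ zSeries := by
  intro h
  obtain ⟨a, ha⟩ := minpoly.mem_range_of_degree_eq_one ℂ zSeries
    (IsAlgClosed.degree_eq_one_of_irreducible ℂ (minpoly.irreducible h.isIntegral))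
  have hcoeff := congrArg (fun x : HahnSeries ℚ ℂ => x.coeff (-1)) ha
  simp [algebraMap_hahnSeries, zSeries] at hcoeff

lemma formalPoint_cons (φ₂ φ₃ : HahnSeries ℚ ℂ) :
    formalPoint ![φ₂, φ₃] =
      ![formalPoint ![φ₂] 0, formalPoint ![φ₂] 1, rSeries φ₃] := by
  ext i : 1
  fin_cases i <;> rfl

lemma formalPoint_comp_castSucc (φ₂ φ₃ : HahnSeries ℚ ℂ) :
    formalPoint ![φ₂, φ₃] ∘ Fin.castSucc = formalPoint ![φ₂] := by
  ext i : 1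
  fin_cases i <;> rfl

lemma aeval_formalPoint_projectedCurve {C : Set (Fin 3 → ℂ)} {φ₂ φ₃ : HahnSeries ℚ ℂ}
    (h : ∀ f ∈ vanishingIdeal ℂ C, aeval (formalPoint ![φ₂, φ₃]) f = 0)
    {f : MvPolynomial (Fin 2) ℂ} (hf : f ∈ vanishingIdeal ℂ (projectedCurve C)) :
    aeval (formalPoint ![φ₂]) f = 0 := by
  have := h _ (mem_vanishingIdeal_projectedCurve_iff.1 hf)
  rwa [aeval_rename, formalPoint_comp_castSucc] at this

/-- The leaves are recovered from the formal equations rather than projected, since the ramification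
index of φ₂ alone may be smaller. -/
lemma IsInfinityBranch.branch_projectedCurve {C : Set (Fin 3 → ℂ)} {φ₂ φ₃ : HahnSeries ℚ ℂ}
    {M : ℝ}
    (h : IsInfinityBranch C ![φ₂, φ₃] M) : IsInfinityBranch (projectedCurve C) ![φ₂] M :=
  isInfinityBranch_of_formal (zeroLocus_vanishingIdeal_projectedCurve C) h.pos
    (fun k => by rw [Subsingleton.elim k 0]; exact h.puiseux 0)
    (fun _ hf => aeval_formalPoint_projectedCurve h.formal hf)
    (fun k => by rw [Subsingleton.elim k 0]; exact h.summable 0)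

/-- The denominator of a lift function does not vanish at the formal points of `C^p`. -/
lemma IsLiftFunction.aeval_formalPoint_ne_zero {C : Set (Fin 3 → ℂ)} (hC : IsIrreducibleCurve C)
    {h₁ h₂ : MvPolynomial (Fin 2) ℂ} (h : IsLiftFunction C h₁ h₂) {φ₂ : HahnSeries ℚ ℂ}
    (hφ : ∀ f ∈ vanishingIdeal ℂ (projectedCurve C), aeval (formalPoint ![φ₂]) f = 0) :
    aeval (formalPoint ![φ₂]) h₂ ≠ 0 := by
  intro h0
  have hmem : h₂ ∈ vanishingIdeal ℂ (projectedCurve C) :=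
    mem_of_aeval_eq_zero_of_transcendental (i := 0)
      (isPrime_vanishingIdeal_projectedCurve hC.prime) (ringKrullDim_projectedCurve_le hC h) hφ
      transcendental_zSeries h0
  obtain ⟨y, hy, hy₂⟩ := h.1
  exact hy₂ (hmem y hy)

lemma IsLiftFunction.rSeries_eq {C : Set (Fin 3 → ℂ)} (hC : IsIrreducibleCurve C)
    {h₁ h₂ : MvPolynomial (Fin 2) ℂ} (h : IsLiftFunction C h₁ h₂) {φ₂ φ₃ : HahnSeries ℚ ℂ}
    (hφ : ∀ f ∈ vanishingIdeal ℂ C, aeval (formalPoint ![φ₂, φ₃]) f = 0) :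
    aeval (formalPoint ![φ₂]) h₂ ≠ 0 ∧
      rSeries φ₃ = aeval (formalPoint ![φ₂]) h₁ / aeval (formalPoint ![φ₂]) h₂ := by
  have hne := h.aeval_formalPoint_ne_zero hC fun f hf => aeval_formalPoint_projectedCurve hφ hf
  refine ⟨hne, ?_⟩
  -- Again the outer h₂ covers the points of C where h₂ vanishes; it cancels at the formal point.
  have hmem : rename Fin.castSucc h₂ * (rename Fin.castSucc h₂ * X 2 - rename Fin.castSucc h₁) ∈
      vanishingIdeal ℂ C := by
    intro x hx
    simp only [map_mul, map_sub, aeval_rename, aeval_X, ← proj_eq_comp_castSucc]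
    by_cases hx₂ : aeval (proj x) h₂ = 0
    · rw [hx₂, zero_mul]
    · have hx2 : x 2 = aeval (proj x) h₁ / aeval (proj x) h₂ := ((h.2 x hx₂).1 hx).2
      rw [hx2, mul_div_cancel₀ _ hx₂, sub_self, mul_zero]
  have h0 := hφ _ hmem
  simp only [map_mul, map_sub, aeval_rename, aeval_X, formalPoint_comp_castSucc] at h0
  rw [eq_div_iff hne, mul_comm, ← sub_eq_zero]
  exact (mul_eq_zero.1 h0).resolve_left hne

lemma IsInfinityBranch.exists_lift {C : Set (Fin 3 → ℂ)} (hC : IsIrreducibleCurve C)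
    {h₁ h₂ : MvPolynomial (Fin 2) ℂ} (h : IsLiftFunction C h₁ h₂) {φ₂ : HahnSeries ℚ ℂ} {M : ℝ}
    (hB : IsInfinityBranch (projectedCurve C) ![φ₂] M) :
    ∃ (φ₃ : HahnSeries ℚ ℂ) (M' : ℝ), IsInfinityBranch C ![φ₂, φ₃] M' := by
  have hne := h.aeval_formalPoint_ne_zero hC hB.formal
  obtain ⟨hN, hj⟩ := ramificationIndex_spec hB.puiseux
  have : NeZero (ramificationIndex ![φ₂]) := ⟨hN.ne'⟩
  have hM0 := hB.pos
  have hM : ‖((M + 1 : ℝ) : ℂ)‖ = M + 1 := by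
    rw [Complex.norm_real, Real.norm_of_nonneg (by linarith)]
  have hconv₂ : IsConvergent (ramificationIndex ![φ₂]) φ₂ :=
    isConvergent_of_summable (hj 0) (z := ((M + 1 : ℝ) : ℂ))
      (norm_pos_iff.1 (by rw [hM]; linarith)) (hB.summable 0 _ (by rw [hM]; linarith))
  have hpt : ∀ i, IsConvergent (ramificationIndex ![φ₂]) (formalPoint ![φ₂] i) := by
    intro i
    fin_cases i
    · exact isConvergent_zSeries _
    · exact (isConvergent_zSeries _).mul hconv₂
  -- Chosen so that r₃ = zφ₃ is h(z, r₂). It is a convergent series in the same root t^(1/N) as φ₂.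
  let φ₃ : HahnSeries ℚ ℂ := zSeries⁻¹ *
    (aeval (formalPoint ![φ₂]) h₁ * (aeval (formalPoint ![φ₂]) h₂)⁻¹)
  have hconv₃ : IsConvergent (ramificationIndex ![φ₂]) φ₃ :=
    (isConvergent_zSeries _).inv.mul
      ((IsConvergent.aeval hpt h₁).mul (IsConvergent.aeval hpt h₂).inv)
  have hr₃ : rSeries φ₃ = aeval (formalPoint ![φ₂]) h₁ / aeval (formalPoint ![φ₂]) h₂ := by
    rw [rSeries, mul_inv_cancel_left₀ zSeries_ne_zero, div_eq_mul_inv]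
  obtain ⟨M₃, hM₃, hs₃⟩ := hconv₃.exists_summable
  refine ⟨φ₃, max M M₃, isInfinityBranch_of_formal hC.closed (lt_max_of_lt_left hB.pos) ?_ ?_ ?_⟩
  · intro k
    fin_cases k
    · exact hB.puiseux 0
    · exact hconv₃.isPuiseux
  · intro f hf
    rw [formalPoint_cons, hr₃]
    exact h.aeval_eq_zero hB.formal hne hf
  · intro k z hz
    fin_cases k
    · exact hB.summable 0 z ((le_max_left _ _).trans_lt hz)
    · exact hs₃ z ((le_max_right _ _).trans_lt hz)

/-! ### Infinity points of branches -/

lemma cons_one_ne_zero {n : ℕ} (m : Fin n → ℂ) : (Fin.cons 1 m : Fin (n + 1) → ℂ) ≠ 0 := fun h =>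
  one_ne_zero (congrFun h 0)

lemma hasResidue_inv_zSeries : HasResidue zSeries⁻¹ 0 := by
  have : zSeries⁻¹ = HahnSeries.single 1 1 := by
    apply inv_eq_of_mul_eq_one_right
    simp [zSeries]
  rw [hasResidue_zero_iff, this, HahnSeries.orderTop_single one_ne_zero]
  exact_mod_cast one_pos

/-- For an infinity branch, the condition on the infinity point follows from the shape of the
series. -/
lemma IsInfinityBranch.isInfinityBranchAt {n : ℕ} {V : Set (Fin (n + 1) → ℂ)}
    {φ : Fin n → HahnSeries ℚ ℂ} {M : ℝ} (h : IsInfinityBranch V φ M)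
    (hφ : ∀ k, ∀ q : ℚ, q < 0 → (φ k).coeff q = 0) {m : Fin n → ℂ}
    (hm : ∀ k, (φ k).coeff 0 = m k) : IsInfinityBranchAt V m φ M := by
  refine ⟨h, isInfinityPoint_of_hasResidue h.formal hasResidue_inv_zSeries (fun i => ?_)
    (cons_one_ne_zero m), hφ, hm⟩
  refine Fin.cases ?_ (fun k => ?_) i
  · have : zSeries⁻¹ * formalPoint φ 0 = HahnSeries.C 1 := by
      rw [map_one]
      exact inv_mul_cancel₀ zSeries_ne_zero
    rw [this]
    exact hasResidue_C 1
  · have : zSeries⁻¹ * formalPoint φ k.succ = φ k := inv_mul_cancel_left₀ zSeries_ne_zero _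
    rw [this, Fin.cons_succ, ← hm k]
    exact hasResidue_of_coeff (hφ k)

lemma hasResidue_inv_of_order_neg {φ : HahnSeries ℚ ℂ} (h : φ.order < 0) :
    HasResidue φ⁻¹ 0 := by
  have hφ : φ ≠ 0 := by
    rintro rfl
    simp at h
  have hord := HahnSeries.order_mul hφ (inv_ne_zero hφ)
  rw [mul_inv_cancel₀ hφ, HahnSeries.order_one] at hord
  rw [hasResidue_zero_iff]
  exact HahnSeries.zero_lt_orderTop_of_order (by linarith)

/-- If no infinity point of `C` has first coordinate zero, then `φ₃` has no terms with negative
exponents as soon as `φ₂` has none. -/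
lemma coeff_eq_zero_of_neg {C : Set (Fin 3 → ℂ)}
    (hC : ∀ m : Fin 3 → ℂ, IsInfinityPoint C m → m 0 ≠ 0) {φ₂ φ₃ : HahnSeries ℚ ℂ}
    (hφ : ∀ f ∈ vanishingIdeal ℂ C, aeval (formalPoint ![φ₂, φ₃]) f = 0)
    (hφ₂ : ∀ q : ℚ, q < 0 → φ₂.coeff q = 0) (q : ℚ) (hq : q < 0) : φ₃.coeff q = 0 := by
  by_contra hne
  have hord : φ₃.order < 0 := (HahnSeries.order_le_of_coeff_ne_zero hne).trans_lt hq
  have hφ₃ : φ₃ ≠ 0 := by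
    rintro rfl
    exact hne rfl
  have hinv := hasResidue_inv_of_order_neg hord
  -- Dividing (z, zφ₂, zφ₃) by zφ₃ gives (1/φ₃, φ₂/φ₃, 1), which tends to (0, 0, 1) because φ₃ has a
  -- pole and φ₂ has none.
  refine hC ![0, 0, 1] (isInfinityPoint_of_hasResidue hφ (l := φ₃⁻¹ * zSeries⁻¹) ?_ ?_ ?_) rfl
  · simpa using hinv.mul hasResidue_inv_zSeries
  · intro i
    rw [mul_assoc]
    fin_cases i
    · have : φ₃⁻¹ * (zSeries⁻¹ * zSeries) = φ₃⁻¹ := by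
        rw [inv_mul_cancel₀ zSeries_ne_zero, mul_one]
      exact this.symm ▸ hinv
    · have : φ₃⁻¹ * (zSeries⁻¹ * rSeries φ₂) = φ₃⁻¹ * φ₂ := by
        rw [rSeries, inv_mul_cancel_left₀ zSeries_ne_zero]
      have h0 : HasResidue (φ₃⁻¹ * φ₂) 0 := by
        simpa using hinv.mul (hasResidue_of_coeff hφ₂)
      exact this.symm ▸ h0
    · have : φ₃⁻¹ * (zSeries⁻¹ * rSeries φ₃) = HahnSeries.C 1 := by
        rw [rSeries, inv_mul_cancel_left₀ zSeries_ne_zero, inv_mul_cancel₀ hφ₃, map_one]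
      exact this.symm ▸ hasResidue_C 1
  · intro h
    simpa using congrFun h 2

end SpaceCurve

end

theorem mainTheorem2 (C : Set (Fin 3 → ℂ))
    (hC : SpaceCurve.IsIrreducibleCurve C)
    (hproj : SpaceCurve.IsValidProjection C) :
    -- a series `r₂` gives a branch of the projection iff it extends to a branch of `C`
    (∀ φ₂ : HahnSeries ℚ ℂ,
      (∃ M : ℝ, SpaceCurve.IsInfinityBranch (SpaceCurve.projectedCurve C) ![φ₂] M) ↔
        ∃ φ₃ : HahnSeries ℚ ℂ, ∃ M : ℝ, SpaceCurve.IsInfinityBranch C ![φ₂, φ₃] M) ∧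
    -- the same for branches at infinity points `(1 : m₂ : 0)` and `(1 : m₂ : m₃ : 0)`, when all
    -- the infinity points of `C` have nonzero first coordinate
    ((∀ m : Fin 3 → ℂ, SpaceCurve.IsInfinityPoint C m → m 0 ≠ 0) →
      ∀ (m₂ : ℂ) (φ₂ : HahnSeries ℚ ℂ),
        (∃ M : ℝ, SpaceCurve.IsInfinityBranchAt (SpaceCurve.projectedCurve C) ![m₂] ![φ₂] M) ↔
          ∃ (m₃ : ℂ) (φ₃ : HahnSeries ℚ ℂ) (M : ℝ),
            SpaceCurve.IsInfinityBranchAt C ![m₂, m₃] ![φ₂, φ₃] M) ∧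
    -- a lift function exists, and `r₃(z) = h(z, r₂(z))` for every lift function `h`
    (∃ h₁ h₂ : MvPolynomial (Fin 2) ℂ, SpaceCurve.IsLiftFunction C h₁ h₂) ∧
    (∀ h₁ h₂ : MvPolynomial (Fin 2) ℂ, SpaceCurve.IsLiftFunction C h₁ h₂ →
      ∀ (φ₂ φ₃ : HahnSeries ℚ ℂ) (M : ℝ), SpaceCurve.IsInfinityBranch C ![φ₂, φ₃] M →
        MvPolynomial.aeval (SpaceCurve.formalPoint ![φ₂]) h₂ ≠ 0 ∧
        SpaceCurve.rSeries φ₃ =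
          MvPolynomial.aeval (SpaceCurve.formalPoint ![φ₂]) h₁ /
            MvPolynomial.aeval (SpaceCurve.formalPoint ![φ₂]) h₂) := by
  obtain ⟨h₁, h₂, h⟩ := hproj.exists_isLiftFunction
  refine ⟨fun φ₂ => ⟨?_, ?_⟩, fun hinf m₂ φ₂ => ⟨?_, ?_⟩, ⟨h₁, h₂, h⟩, ?_⟩
  · rintro ⟨M, hB⟩
    exact hB.exists_lift hC h
  · rintro ⟨φ₃, M, hB⟩
    exact ⟨M, hB.branch_projectedCurve⟩
  · rintro ⟨M, hB⟩
    obtain ⟨φ₃, M', hB'⟩ := hB.toIsInfinityBranch.exists_lift hC h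
    have hφ₃ := SpaceCurve.coeff_eq_zero_of_neg hinf hB'.formal (hB.order 0)
    refine ⟨φ₃.coeff 0, φ₃, M', hB'.isInfinityBranchAt (fun k => ?_) (fun k => ?_)⟩
    · fin_cases k
      · exact hB.order 0
      · exact hφ₃
    · fin_cases k
      · exact hB.constantTerm 0
      · rfl
  · rintro ⟨m₃, φ₃, M, hB⟩
    refine ⟨M, hB.toIsInfinityBranch.branch_projectedCurve.isInfinityBranchAt (fun k => ?_)
      (fun k => ?_)⟩
    · rw [Subsingleton.elim k 0]
      exact hB.order 0
    · rw [Subsingleton.elim k 0]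
      exact hB.constantTerm 0
  · intro g₁ g₂ hg φ₂ φ₃ M hB
    exact hg.rSeries_eq hC hB.formal
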